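/- **Language.** Let $\mathcal L_Q$ be the predicate language with connectives $\bot,\sim,\wedge,\vee,\to$, quantifiers $\forall,\exists$, countably infinitely many constants $\mathsf{Con}=\{c_1,c_2,\dots\}$, variables $v_1,v_2,\dots$, and, for each $n\in\mathbb N$, predicate symbols $P^n_1,P^n_2,\dots$ of arity $n$; terms are constants and variables. Formulas are taken up to renaming of bound variables, $\neg A$ abbreviates $A\to\bot$, $A\leftrightarrow B$ abbreviates $(A\to B)\wedge(B\to A)$, and $\mathsf{Sent}_Q$ is the set of sentences (closed formulas). **Systems.** $\mathbf{QDN4}$ has the rules modus ponens and generalization (from $A$ infer $\forall xA$) and the axiom schemata: $A\to(B\to A)$; $(A\to(B\to C))\to((A\to B)\to(A\to C))$; $(A\wedge B)\to A$; $(A\wedge B)\to B$; $(C\to A)\to((C\to B)\to(C\to(A\wedge B)))$; $A\to(A\vee B)$; $B\to(A\vee B)$; $(A\to C)\to((B\to C)\to((A\vee B)\to C))$; $\bot\to A$; $A(t)\to\exists xA$; $\forall x(A\to B)\to(\exists xA\to B)$ and $\forall x(B\to A)\to(B\to\forall xA)$, with $x$ not free in $B$; $\forall xA\to A(t)$; $A\to{\sim}\bot$;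 ${\sim}{\sim}A\leftrightarrow A$; ${\sim}(A\wedge B)\leftrightarrow({\sim}A\vee{\sim}B)$; ${\sim}(A\vee B)\leftrightarrow({\sim}A\wedge{\sim}B)$; ${\sim}(A\to B)\leftrightarrow(\neg\neg A\wedge{\sim}B)$; ${\sim}\forall xA\leftrightarrow\exists x{\sim}A$; ${\sim}\exists xA\leftrightarrow\forall x{\sim}A$. $\mathbf{QDN3}$ has in addition the axiom schema ${\sim}A\to\neg A$. Write $\Gamma\vdash_{d4}A$ and $\Gamma\vdash_{d3}A$ if there is a finite derivation of $A$ whose entries are elements of $\Gamma$, axioms of the respective system, or follow from earlier entries by one of the rules. **Models.** A $\mathbf{QDN4}$-model is a quadruple $\langle W,\le,D,V\rangle$ where $(W,\le)$ is a nonempty partially ordered set; $D$ assigns to each $w\in W$ a set $D(w)\supseteq\mathsf{Con}$, with $D(w)\subseteq D(x)$ whenever $w\le x$; and $V$ assigns to each $w\in W$ and each $n$-ary predicate symbol $P$ sets $V^+(w,P),V^-(w,P)\subseteq D(w)^n$ with $V^{\pm}(w,P)\subseteq V^{\pm}(x,P)$ whenever $w\le x$. A $\mathbf{QDN3}$-model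 is a $\mathbf{QDN4}$-model with $V^+(w,P)\cap V^-(w,P)=\emptyset$ for all $w$ and $P$. The interpretation $I(w,A)\subseteq\{0,1\}$ of sentences $A$ (of the language expanded by the elements of $\bigcup_{w}D(w)$ as constants) is given by: - $1\in I(w,P(\vec d))$ iff $\vec d\in V^+(w,P)$; $0\in I(w,P(\vec d))$ iff $\vec d\in V^-(w,P)$; - $1\notin I(w,\bot)$ and $0\in I(w,\bot)$; - $1\in I(w,{\sim}A)$ iff $0\in I(w,A)$; $0\in I(w,{\sim}A)$ iff $1\in I(w,A)$; - $1\in I(w,A\wedge B)$ iff $1\in I(w,A)$ and $1\in I(w,B)$; $0\in I(w,A\wedge B)$ iff $0\in I(w,A)$ or $0\in I(w,B)$; - $1\in I(w,A\vee B)$ iff $1\in I(w,A)$ or $1\in I(w,B)$; $0\in I(w,A\vee B)$ iff $0\in I(w,A)$ and $0\in I(w,B)$; - $1\in I(w,A\to B)$ iff for all $x\ge w$, $1\notin I(x,A)$ or $1\in I(x,B)$; $0\in I(w,A\to B)$ iff (for all $x\ge w$ there is $y\ge x$ with $1\in I(y,A)$) and $0\in I(w,B)$; - $1\in I(w,\forall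 xA)$ iff for all $u\ge w$ and all $d\in D(u)$, $1\in I(u,A(d))$; $0\in I(w,\forall xA)$ iff $0\in I(w,A(d))$ for some $d\in D(w)$; - $1\in I(w,\exists xA)$ iff $1\in I(w,A(d))$ for some $d\in D(w)$; $0\in I(w,\exists xA)$ iff for all $u\ge w$ and all $d\in D(u)$, $0\in I(u,A(d))$. For $k\in\{3,4\}$ write $\Gamma\models_{dk}A$ if for every $\mathbf{QDN}k$-model and every $w\in W$: if $1\in I(w,B)$ for all $B\in\Gamma$, then $1\in I(w,A)$. **Theorem** (soundness and completeness of $\mathbf{QDN3}$ and $\mathbf{QDN4}$). Let $k\in\{3,4\}$. For all $\Gamma\cup\{A\}\subseteq\mathsf{Sent}_Q$, $$\Gamma\vdash_{dk}A\iff\Gamma\models_{dk}A .$$ -/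

import Mathlib

universe u v

namespace DN

/-- Terms of the predicate language: the constants `c₀, c₁, …` and the variables.
Variables are de Bruijn indices, i.e. formulas are taken up to renaming of bound variables. -/
inductive Tm : Type
  | con (i : ℕ) : Tm
  | var (i : ℕ) : Tm

/-- Formulas. `atom n i t` is the `i`-th `n`-ary predicate symbol applied to `t`; `neg` is the
strong negation `∼`. In `all A` and `ex A` the variable `0` of `A` is bound, and the variable
`k + 1` of `A` is the variable `k` of the quantified formula. -/
inductive Form : Type
  | bot : Form
  | atom (n i : ℕ) (t : Fin n → Tm) : Form
  | neg (A : Form) : Form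
  | and (A B : Form) : Form
  | or (A B : Form) : Form
  | imp (A B : Form) : Form
  | all (A : Form) : Form
  | ex (A : Form) : Form

/-- Simultaneous substitution of terms for variables in a term. -/
def Tm.subst (σ : ℕ → Tm) : Tm → Tm
  | Tm.con i => Tm.con i
  | Tm.var i => σ i

/-- The substitution to be used below a quantifier. -/
def liftSubst (σ : ℕ → Tm) : ℕ → Tm
  | 0 => Tm.var 0
  | k + 1 => (σ k).subst (fun j => Tm.var (j + 1))

namespace Form

/-- Capture-avoiding simultaneous substitution of terms for the free variables. -/
def subst : (ℕ → Tm) → Form → Form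
  | _, bot => bot
  | σ, atom n i t => atom n i (fun j => (t j).subst σ)
  | σ, neg A => neg (subst σ A)
  | σ, and A B => and (subst σ A) (subst σ B)
  | σ, or A B => or (subst σ A) (subst σ B)
  | σ, imp A B => imp (subst σ A) (subst σ B)
  | σ, all A => all (subst (liftSubst σ) A)
  | σ, ex A => ex (subst (liftSubst σ) A)

/-- `A.shift` is `A`, seen below one more quantifier whose variable is not free in `A`. -/
def shift (A : Form) : Form := A.subst (fun k => Tm.var (k + 1))

/-- `A.inst t` is `A(t)`: the term `t` replaces the variable bound in `all A` or `ex A`. -/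
def inst (A : Form) (t : Tm) : Form :=
  A.subst (fun k => Nat.casesOn k t (fun j => Tm.var j))

/-- Intuitionistic negation `¬ A`, an abbreviation of `A → ⊥`. -/
def inot (A : Form) : Form := imp A bot

/-- `A ↔ B`, an abbreviation of `(A → B) ∧ (B → A)`. -/
def iff (A B : Form) : Form := and (imp A B) (imp B A)

/-- All free variables of the formula are among `0, …, k - 1`. -/
def FreeBelow : ℕ → Form → Prop
  | _, bot => True
  | k, atom _ _ t => ∀ j x, t j = Tm.var x → x < k
  | k, neg A => FreeBelow k A
  | k, and A B => FreeBelow k A ∧ FreeBelow k B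
  | k, or A B => FreeBelow k A ∧ FreeBelow k B
  | k, imp A B => FreeBelow k A ∧ FreeBelow k B
  | k, all A => FreeBelow (k + 1) A
  | k, ex A => FreeBelow (k + 1) A

/-- A sentence is a formula without free variables. -/
def IsSentence (A : Form) : Prop := FreeBelow 0 A

end Form

open Form in
/-- The axioms of `QDN4`. -/
inductive AxQDN4 : Form → Prop
  | k (A B : Form) : AxQDN4 (imp A (imp B A))
  | s (A B C : Form) :
      AxQDN4 (imp (imp A (imp B C)) (imp (imp A B) (imp A C)))
  | and_left (A B : Form) : AxQDN4 (imp (and A B) A)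
  | and_right (A B : Form) : AxQDN4 (imp (and A B) B)
  | and_intro (A B C : Form) :
      AxQDN4 (imp (imp C A) (imp (imp C B) (imp C (and A B))))
  | or_left (A B : Form) : AxQDN4 (imp A (or A B))
  | or_right (A B : Form) : AxQDN4 (imp B (or A B))
  | or_elim (A B C : Form) :
      AxQDN4 (imp (imp A C) (imp (imp B C) (imp (or A B) C)))
  | efq (A : Form) : AxQDN4 (imp bot A)
  | ex_intro (A : Form) (t : Tm) : AxQDN4 (imp (A.inst t) (ex A))
  | ex_elim (A B : Form) : AxQDN4 (imp (all (imp A B.shift)) (imp (ex A) B))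
  | all_intro (A B : Form) : AxQDN4 (imp (all (imp B.shift A)) (imp B (all A)))
  | all_elim (A : Form) (t : Tm) : AxQDN4 (imp (all A) (A.inst t))
  | neg_bot (A : Form) : AxQDN4 (imp A (neg bot))
  | neg_neg (A : Form) : AxQDN4 (iff (neg (neg A)) A)
  | neg_and (A B : Form) : AxQDN4 (iff (neg (and A B)) (or (neg A) (neg B)))
  | neg_or (A B : Form) : AxQDN4 (iff (neg (or A B)) (and (neg A) (neg B)))
  | neg_imp (A B : Form) :
      AxQDN4 (iff (neg (imp A B)) (and (inot (inot A)) (neg B)))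
  | neg_all (A : Form) : AxQDN4 (iff (neg (all A)) (ex (neg A)))
  | neg_ex (A : Form) : AxQDN4 (iff (neg (ex A)) (all (neg A)))

/-- The axioms of `QDN3`: those of `QDN4` and `∼A → ¬A`. -/
inductive AxQDN3 : Form → Prop
  | of_QDN4 {A : Form} (h : AxQDN4 A) : AxQDN3 A
  | explosion (A : Form) : AxQDN3 (Form.imp (Form.neg A) (Form.inot A))

/-- Derivability from the set of premises `Γ` by the axioms `Ax`, modus ponens and
generalization. -/
inductive Derives (Ax : Form → Prop) (Γ : Set Form) : Form → Prop
  | prem {A : Form} (h : A ∈ Γ) : Derives Ax Γ A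
  | ax {A : Form} (h : Ax A) : Derives Ax Γ A
  | mp {A B : Form} (hA : Derives Ax Γ A) (hAB : Derives Ax Γ (Form.imp A B)) :
      Derives Ax Γ B
  | gen {A : Form} (h : Derives Ax Γ A) : Derives Ax Γ (Form.all A)

/-- A Kripke model for `QDN4`: a nonempty partially ordered set `W` of states with increasing
domains `D w ⊆ U`, each containing all constants (through the injection `con`), and with
monotone extensions `Vpos` and anti-extensions `Vneg` of the predicate symbols;
`Vpos w n i` is the extension at `w` of the `i`-th `n`-ary symbol. -/
structure KripkeModel : Type (max (u + 1) (v + 1)) where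
  W : Type u
  [order : PartialOrder W]
  [nonempty : Nonempty W]
  U : Type v
  con : ℕ → U
  con_injective : Function.Injective con
  D : W → Set U
  con_mem : ∀ w c, con c ∈ D w
  D_mono : ∀ {w x}, w ≤ x → D w ⊆ D x
  Vpos : W → (n i : ℕ) → Set (Fin n → U)
  Vneg : W → (n i : ℕ) → Set (Fin n → U)
  Vpos_dom : ∀ w n i d, d ∈ Vpos w n i → ∀ j, d j ∈ D w
  Vneg_dom : ∀ w n i d, d ∈ Vneg w n i → ∀ j, d j ∈ D w
  Vpos_mono : ∀ {w x}, w ≤ x → ∀ n i, Vpos w n i ⊆ Vpos x n i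
  Vneg_mono : ∀ {w x}, w ≤ x → ∀ n i, Vneg w n i ⊆ Vneg x n i

attribute [instance] KripkeModel.order KripkeModel.nonempty

namespace KripkeModel

/-- The models for `QDN3`: no tuple is both in the extension and in the anti-extension. -/
def Disjointness (M : KripkeModel.{u, v}) : Prop :=
  ∀ w n i, M.Vpos w n i ∩ M.Vneg w n i = ∅

/-- The value of a term when the variables denote the objects given by `ρ`. -/
def val (M : KripkeModel.{u, v}) (ρ : ℕ → M.U) : Tm → M.U
  | Tm.con c => M.con c
  | Tm.var x => ρ x

/-- The assignment that gives `d` to the variable of a quantifier and `ρ` to the others. -/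
def push (M : KripkeModel.{u, v}) (d : M.U) (ρ : ℕ → M.U) : ℕ → M.U
  | 0 => d
  | k + 1 => ρ k

/-- The interpretation. `M.I A true w ρ` means `1 ∈ I(w, A)` and `M.I A false w ρ` means
`0 ∈ I(w, A)`, where the free variables of `A` are replaced by the objects given by `ρ`. -/
def I (M : KripkeModel.{u, v}) : Form → Bool → M.W → (ℕ → M.U) → Prop
  | Form.bot, true, _, _ => False
  | Form.bot, false, _, _ => True
  | Form.atom n i t, true, w, ρ => (fun j => M.val ρ (t j)) ∈ M.Vpos w n i
  | Form.atom n i t, false, w, ρ => (fun j => M.val ρ (t j)) ∈ M.Vneg w n i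
  | Form.neg A, true, w, ρ => I M A false w ρ
  | Form.neg A, false, w, ρ => I M A true w ρ
  | Form.and A B, true, w, ρ => I M A true w ρ ∧ I M B true w ρ
  | Form.and A B, false, w, ρ => I M A false w ρ ∨ I M B false w ρ
  | Form.or A B, true, w, ρ => I M A true w ρ ∨ I M B true w ρ
  | Form.or A B, false, w, ρ => I M A false w ρ ∧ I M B false w ρ
  | Form.imp A B, true, w, ρ => ∀ x, w ≤ x → (¬ I M A true x ρ ∨ I M B true x ρ)
  | Form.imp A B, false, w, ρ =>
      (∀ x, w ≤ x → ∃ y, x ≤ y ∧ I M A true y ρ) ∧ I M B false w ρ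
  | Form.all A, true, w, ρ => ∀ x, w ≤ x → ∀ d ∈ M.D x, I M A true x (M.push d ρ)
  | Form.all A, false, w, ρ => ∃ d ∈ M.D w, I M A false w (M.push d ρ)
  | Form.ex A, true, w, ρ => ∃ d ∈ M.D w, I M A true w (M.push d ρ)
  | Form.ex A, false, w, ρ => ∀ x, w ≤ x → ∀ d ∈ M.D x, I M A false x (M.push d ρ)

/-- `1 ∈ I(w, A)` for a sentence `A`; the assignment of the (absent) free variables is
irrelevant, and is taken to be constant. -/
def Holds (M : KripkeModel.{u, v}) (w : M.W) (A : Form) : Prop :=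
  M.I A true w (fun _ => M.con 0)

end KripkeModel

/-- Semantic consequence over all `QDN4`-models (with states and objects in given universes). -/
def ConsQDN4 (Γ : Set Form) (A : Form) : Prop :=
  ∀ M : KripkeModel.{u, v}, ∀ w : M.W, (∀ B ∈ Γ, M.Holds w B) → M.Holds w A

/-- Semantic consequence over all `QDN3`-models. -/
def ConsQDN3 (Γ : Set Form) (A : Form) : Prop :=
  ∀ M : KripkeModel.{u, v}, M.Disjointness →
    ∀ w : M.W, (∀ B ∈ Γ, M.Holds w B) → M.Holds w A

end DN

namespace DN

/-! ### Substitution and free variables -/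

/-! Soundness is an induction on derivations over all states and assignments at once
(`I_of_derives`). Truth and falsity persist upwards (`I_mono`), and the premises, being sentences,
ignore the assignment, so generalization is harmless.

Completeness is a Henkin argument. The states of the canonical model are prime theories with
witnesses, ordered by inclusion, and variables name the objects. Each level of variables adds
infinitely many to the one below, so a theory can always be extended with fresh witnesses
(`exists_saturated`, `World.exists_extension`). This gives the implication and universal clauses
their later states (`imp_mem_iff`, `all_mem_iff`).

Strong negation needs no extra construction: its axioms transcribe the falsity clauses. Hence
`I_canonicalModel_iff` shows by one induction that truth of `A` is membership of `A` and falsity is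
membership of `∼A`. The axiom for `∼(A → B)` fits because `¬¬A` says that `A` holds somewhere above
every later state.

Since these theories contain free variables, the construction uses `Entails`, where generalization
is confined to theorems; `Entails.derives` returns to the original calculus. For `QDN3`, explosion
on atoms makes the canonical model disjoint. -/

theorem Tm.subst_subst (t : Tm) (σ τ : ℕ → Tm) :
    (t.subst σ).subst τ = t.subst (fun k => (σ k).subst τ) := by
  cases t <;> rfl

theorem liftSubst_comp (σ τ : ℕ → Tm) :
    (fun k => (liftSubst σ k).subst (liftSubst τ)) = liftSubst (fun k => (σ k).subst τ) := by
  funext k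
  cases k with
  | zero => rfl
  | succ k =>
    simp only [liftSubst, Tm.subst_subst]
    rfl

theorem liftSubst_var : liftSubst Tm.var = Tm.var := by
  funext k
  cases k <;> rfl

theorem Tm.subst_var (t : Tm) : t.subst Tm.var = t := by
  cases t <;> rfl

/-- The variables of a term. -/
def Tm.fv : Tm → Set ℕ
  | Tm.con _ => ∅
  | Tm.var x => {x}

theorem Tm.finite_fv (t : Tm) : t.fv.Finite := by
  cases t <;> simp [Tm.fv]

theorem Tm.fv_subst_subset {t : Tm} {σ : ℕ → Tm} {X : Set ℕ} (h : ∀ x ∈ t.fv, (σ x).fv ⊆ X) :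
    (t.subst σ).fv ⊆ X := by
  cases t with
  | con => simp [Tm.subst, Tm.fv]
  | var x => exact h x rfl

theorem Tm.subst_congr {t : Tm} {σ τ : ℕ → Tm} (h : ∀ x ∈ t.fv, σ x = τ x) :
    t.subst σ = t.subst τ := by
  cases t with
  | con => rfl
  | var x => exact h x rfl

namespace Form

/-- The free variables of a formula. -/
def fv : Form → Set ℕ
  | bot => ∅
  | atom _ _ t => ⋃ j, (t j).fv
  | neg A => fv A
  | and A B => fv A ∪ fv B
  | or A B => fv A ∪ fv B
  | imp A B => fv A ∪ fv B
  | all A => {x | x + 1 ∈ fv A}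
  | ex A => {x | x + 1 ∈ fv A}

theorem finite_fv (A : Form) : A.fv.Finite := by
  induction A with
  | bot => exact Set.finite_empty
  | atom n i t => exact Set.finite_iUnion fun j => (t j).finite_fv
  | neg A ih => exact ih
  | and A B ihA ihB => exact ihA.union ihB
  | or A B ihA ihB => exact ihA.union ihB
  | imp A B ihA ihB => exact ihA.union ihB
  | all A ih => exact ih.preimage (Nat.succ_injective.injOn)
  | ex A ih => exact ih.preimage (Nat.succ_injective.injOn)

theorem FreeBelow.lt_of_mem_fv {k : ℕ} {A : Form} (h : FreeBelow k A) {x : ℕ} (hx : x ∈ A.fv) :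
    x < k := by
  induction A generalizing k x with
  | bot => exact hx.elim
  | atom n i t =>
    obtain ⟨j, hj⟩ := Set.mem_iUnion.1 hx
    refine h j x ?_
    cases ht : t j with
    | con => simp [ht, Tm.fv] at hj
    | var y => simp [ht, Tm.fv] at hj; rw [hj]
  | neg A ih => exact ih h hx
  | and A B ihA ihB => exact hx.elim (ihA h.1) (ihB h.2)
  | or A B ihA ihB => exact hx.elim (ihA h.1) (ihB h.2)
  | imp A B ihA ihB => exact hx.elim (ihA h.1) (ihB h.2)
  | all A ih => exact Nat.lt_of_succ_lt_succ (ih h hx)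
  | ex A ih => exact Nat.lt_of_succ_lt_succ (ih h hx)

theorem IsSentence.fv_eq_empty {A : Form} (h : A.IsSentence) : A.fv = ∅ :=
  Set.eq_empty_of_forall_notMem fun _ hx => Nat.not_lt_zero _ (FreeBelow.lt_of_mem_fv h hx)

theorem subst_subst (A : Form) (σ τ : ℕ → Tm) :
    (A.subst σ).subst τ = A.subst (fun k => (σ k).subst τ) := by
  induction A generalizing σ τ with
  | bot => rfl
  | atom n i t => simp [subst, Tm.subst_subst]
  | neg A ih => simp [subst, ih]
  | and A B ihA ihB => simp [subst, ihA, ihB]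
  | or A B ihA ihB => simp [subst, ihA, ihB]
  | imp A B ihA ihB => simp [subst, ihA, ihB]
  | all A ih => simp [subst, ih, liftSubst_comp]
  | ex A ih => simp [subst, ih, liftSubst_comp]

theorem liftSubst_congr {X : Set ℕ} {σ τ : ℕ → Tm} (h : ∀ x, x + 1 ∈ X → σ x = τ x) :
    ∀ x ∈ X, liftSubst σ x = liftSubst τ x := by
  rintro (_ | x) hx
  · rfl
  · simp [liftSubst, h x hx]

theorem subst_congr {A : Form} {σ τ : ℕ → Tm} (h : ∀ x ∈ A.fv, σ x = τ x) :
    A.subst σ = A.subst τ := by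
  induction A generalizing σ τ with
  | bot => rfl
  | atom n i t =>
    have : ∀ j, (t j).subst σ = (t j).subst τ := fun j =>
      Tm.subst_congr fun x hx => h x (Set.mem_iUnion.2 ⟨j, hx⟩)
    simp [subst, this]
  | neg A ih => simp only [subst, ih h]
  | and A B ihA ihB =>
    simp only [subst, ihA fun x hx => h x (Or.inl hx), ihB fun x hx => h x (Or.inr hx)]
  | or A B ihA ihB =>
    simp only [subst, ihA fun x hx => h x (Or.inl hx), ihB fun x hx => h x (Or.inr hx)]
  | imp A B ihA ihB =>
    simp only [subst, ihA fun x hx => h x (Or.inl hx), ihB fun x hx => h x (Or.inr hx)]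
  | all A ih => simp only [subst, ih (liftSubst_congr h)]
  | ex A ih => simp only [subst, ih (liftSubst_congr h)]

theorem subst_var (A : Form) : A.subst Tm.var = A := by
  induction A with
  | bot => rfl
  | atom n i t => simp [subst, Tm.subst_var]
  | neg A ih => simp [subst, ih]
  | and A B ihA ihB => simp [subst, ihA, ihB]
  | or A B ihA ihB => simp [subst, ihA, ihB]
  | imp A B ihA ihB => simp [subst, ihA, ihB]
  | all A ih => simp [subst, ih, liftSubst_var]
  | ex A ih => simp [subst, ih, liftSubst_var]

theorem IsSentence.subst_eq {A : Form} (h : A.IsSentence) (σ : ℕ → Tm) : A.subst σ = A := by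
  conv_rhs => rw [← A.subst_var]
  exact subst_congr (by simp [h.fv_eq_empty])

theorem fv_liftSubst_subset {X Y : Set ℕ} {σ : ℕ → Tm} (h : ∀ x, x + 1 ∈ Y → (σ x).fv ⊆ X) :
    ∀ x ∈ Y, (liftSubst σ x).fv ⊆ {y | y = 0 ∨ ∃ z ∈ X, y = z + 1} := by
  rintro (_ | x) hx
  · simp [liftSubst, Tm.fv]
  · exact Tm.fv_subst_subset fun y hy => by simpa [Tm.fv] using h x hx hy

theorem fv_subst_subset {A : Form} {σ : ℕ → Tm} {X : Set ℕ} (h : ∀ x ∈ A.fv, (σ x).fv ⊆ X) :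
    (A.subst σ).fv ⊆ X := by
  induction A generalizing σ X with
  | bot => exact Set.empty_subset _
  | atom n i t =>
    exact Set.iUnion_subset fun j => Tm.fv_subst_subset fun x hx => h x (Set.mem_iUnion.2 ⟨j, hx⟩)
  | neg A ih => exact ih h
  | and A B ihA ihB =>
    exact Set.union_subset (ihA fun x hx => h x (Or.inl hx)) (ihB fun x hx => h x (Or.inr hx))
  | or A B ihA ihB =>
    exact Set.union_subset (ihA fun x hx => h x (Or.inl hx)) (ihB fun x hx => h x (Or.inr hx))
  | imp A B ihA ihB =>
    exact Set.union_subset (ihA fun x hx => h x (Or.inl hx)) (ihB fun x hx => h x (Or.inr hx))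
  | all A ih =>
    intro y hy
    simpa using ih (fv_liftSubst_subset h) hy
  | ex A ih =>
    intro y hy
    simpa using ih (fv_liftSubst_subset h) hy

/-- Together with `shift_subst`, this is why the quantifier axioms are closed under substitution. -/
theorem inst_subst (A : Form) (t : Tm) (σ : ℕ → Tm) :
    (A.inst t).subst σ = (A.subst (liftSubst σ)).inst (t.subst σ) := by
  simp only [inst, subst_subst]
  congr 1
  funext k
  cases k with
  | zero => rfl
  | succ k =>
    simp only [liftSubst, Tm.subst_subst]
    exact (Tm.subst_var _).symm

theorem shift_subst (A : Form) (σ : ℕ → Tm) :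
    A.shift.subst (liftSubst σ) = (A.subst σ).shift := by
  simp only [shift, subst_subst]
  rfl

theorem shift_inst (A : Form) (t : Tm) : A.shift.inst t = A := by
  simp only [shift, inst, subst_subst]
  exact A.subst_var

/-- Instantiating a formula, seen below one more quantifier, with the variable of that quantifier
gives back the formula. -/
theorem inst_lift_shift (A : Form) :
    (A.subst (liftSubst fun k => Tm.var (k + 1))).inst (Tm.var 0) = A := by
  conv_rhs => rw [← A.subst_var]
  simp only [inst, subst_subst]
  congr 1
  funext k
  cases k <;> rfl

theorem fv_inst_subset {A : Form} {t : Tm} {X : Set ℕ} (hA : A.all.fv ⊆ X) (ht : t.fv ⊆ X) :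
    (A.inst t).fv ⊆ X := by
  refine fv_subst_subset ?_
  rintro (_ | x) hx
  · exact ht
  · simpa [Tm.fv] using hA hx

/-- Renames the variable `x` to the variable of a new quantifier. -/
def abstractVar (x : ℕ) : ℕ → Tm := fun k => if k = x then Tm.var 0 else Tm.var (k + 1)

theorem subst_abstractVar {A : Form} {x : ℕ} (h : x ∉ A.fv) :
    A.subst (abstractVar x) = A.shift :=
  subst_congr fun y hy => if_neg fun hyx : y = x => h (hyx ▸ hy)

/-- Turns a fresh free variable back into the bound index, so that reasoning with a named fresh
variable reduces to the de Bruijn generalization rule. -/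
theorem inst_subst_abstractVar {A : Form} {x : ℕ} (h : x ∉ A.all.fv) :
    (A.inst (Tm.var x)).subst (abstractVar x) = A := by
  conv_rhs => rw [← A.subst_var]
  simp only [inst, subst_subst]
  refine subst_congr ?_
  rintro (_ | y) hy
  · simp [Tm.subst, abstractVar]
  · have : y ≠ x := fun hyx => h (hyx ▸ hy)
    simp [Tm.subst, abstractVar, this]

/-- The height of the syntax tree. -/
def height : Form → ℕ
  | bot => 0
  | atom _ _ _ => 0
  | neg A => A.height + 1
  | and A B => max A.height B.height + 1
  | or A B => max A.height B.height + 1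
  | imp A B => max A.height B.height + 1
  | all A => A.height + 1
  | ex A => A.height + 1

end Form

/-! ### Countability of the language -/

instance : Countable Tm := by
  have : Function.Surjective (fun p : ℕ ⊕ ℕ => p.elim Tm.con Tm.var) := by
    rintro (i | i)
    · exact ⟨Sum.inl i, rfl⟩
    · exact ⟨Sum.inr i, rfl⟩
  exact this.countable

namespace Form

theorem countable_height_le (n : ℕ) : {A : Form | A.height ≤ n}.Countable := by
  have hatom : (Set.range fun p : (Σ n : ℕ, ℕ × (Fin n → Tm)) => atom p.1 p.2.1 p.2.2).Countable :=
    Set.countable_range _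
  induction n with
  | zero =>
    refine (hatom.insert bot).mono ?_
    rintro (_ | ⟨n, i, t⟩ | _ | _ | _ | _ | _ | _) h
    · exact Or.inl rfl
    · exact Or.inr ⟨⟨n, i, t⟩, rfl⟩
    all_goals simp [height] at h
  | succ n ih =>
    refine ((((((hatom.insert bot).union (ih.image neg)).union (ih.image2 ih and)).union
      (ih.image2 ih or)).union (ih.image2 ih imp)).union
      ((ih.image all).union (ih.image ex))).mono ?_
    rintro (_ | ⟨n, i, t⟩ | A | ⟨A, B⟩ | ⟨A, B⟩ | ⟨A, B⟩ | A | A) h <;>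
      simp [height] at h ⊢ <;> simp [h]
instance : Countable Form := by
  rw [← Set.countable_univ_iff]
  refine (Set.countable_iUnion countable_height_le).mono fun A _ => ?_
  exact Set.mem_iUnion.2 ⟨A.height, le_refl A.height⟩

end Form

/-! ### Derivability -/

/-- A set of axioms that is closed under substitution and contains the axioms of `QDN4`. -/
class IsAxiomSystem (Ax : Form → Prop) : Prop where
  of_QDN4 : ∀ {A}, AxQDN4 A → Ax A
  subst : ∀ {A}, Ax A → ∀ σ, Ax (A.subst σ)

instance : IsAxiomSystem AxQDN4 where
  of_QDN4 := id
  subst := by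
    intro A h σ
    cases h with
    | ex_elim A B =>
      have := AxQDN4.ex_elim (A.subst (liftSubst σ)) (B.subst σ)
      rwa [← Form.shift_subst] at this
    | all_intro A B =>
      have := AxQDN4.all_intro (A.subst (liftSubst σ)) (B.subst σ)
      rwa [← Form.shift_subst] at this
    | ex_intro A t =>
      have := AxQDN4.ex_intro (A.subst (liftSubst σ)) (t.subst σ)
      rwa [← Form.inst_subst] at this
    | all_elim A t =>
      have := AxQDN4.all_elim (A.subst (liftSubst σ)) (t.subst σ)
      rwa [← Form.inst_subst] at this
    | _ => constructor

instance : IsAxiomSystem AxQDN3 where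
  of_QDN4 := AxQDN3.of_QDN4
  subst := by
    intro A h σ
    cases h with
    | of_QDN4 h => exact AxQDN3.of_QDN4 (IsAxiomSystem.subst h σ)
    | explosion A => exact AxQDN3.explosion (A.subst σ)

theorem Derives.subst {Ax : Form → Prop} [IsAxiomSystem Ax] {A : Form} (h : Derives Ax ∅ A)
    (σ : ℕ → Tm) : Derives Ax ∅ (A.subst σ) := by
  induction h generalizing σ with
  | prem h => exact h.elim
  | ax h => exact .ax (IsAxiomSystem.subst h σ)
  | mp _ _ ih₁ ih₂ => exact .mp (ih₁ σ) (ih₂ σ)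
  | gen _ ih => exact .gen (ih _)

/-- Derivability from premises that may contain free variables, over which one may not
generalize. -/
inductive Entails (Ax : Form → Prop) (Γ : Set Form) : Form → Prop
  | prem {A : Form} (h : A ∈ Γ) : Entails Ax Γ A
  | thm {A : Form} (h : Derives Ax ∅ A) : Entails Ax Γ A
  | mp {A B : Form} (hA : Entails Ax Γ A) (hAB : Entails Ax Γ (Form.imp A B)) : Entails Ax Γ B

theorem Derives.of_empty {Ax : Form → Prop} {Γ : Set Form} {A : Form} (h : Derives Ax ∅ A) :
    Derives Ax Γ A := by
  induction h with
  | prem h => exact h.elim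
  | ax h => exact .ax h
  | mp _ _ ih₁ ih₂ => exact .mp ih₁ ih₂
  | gen _ ih => exact .gen ih

/-- Only this direction is needed for completeness: what is not derivable is not entailed either,
and the extension to a saturated theory can start from there. -/
theorem Entails.derives {Ax : Form → Prop} {Γ : Set Form} {A : Form} (h : Entails Ax Γ A) :
    Derives Ax Γ A := by
  induction h with
  | prem h => exact .prem h
  | thm h => exact h.of_empty
  | mp _ _ ih₁ ih₂ => exact .mp ih₁ ih₂

namespace Entails

open Form

variable {Ax : Form → Prop} {Γ Δ : Set Form} {A B C : Form}

theorem mono (h : Entails Ax Γ A) (hΓ : Γ ⊆ Δ) : Entails Ax Δ A := by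
  induction h with
  | prem h => exact .prem (hΓ h)
  | thm h => exact .thm h
  | mp _ _ ih₁ ih₂ => exact .mp ih₁ ih₂

theorem exists_of_iUnion {S : ℕ → Set Form} (hS : Monotone S) (h : Entails Ax (⋃ n, S n) A) :
    ∃ n, Entails Ax (S n) A := by
  induction h with
  | prem h =>
    obtain ⟨n, hn⟩ := Set.mem_iUnion.1 h
    exact ⟨n, .prem hn⟩
  | thm h => exact ⟨0, .thm h⟩
  | mp _ _ ih₁ ih₂ =>
    obtain ⟨m, hm⟩ := ih₁
    obtain ⟨n, hn⟩ := ih₂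
    exact ⟨max m n, .mp (hm.mono (hS (le_max_left _ _))) (hn.mono (hS (le_max_right _ _)))⟩

variable [IsAxiomSystem Ax]

theorem ax (h : AxQDN4 A) : Entails Ax Γ A := .thm (.ax (IsAxiomSystem.of_QDN4 h))

/-- No side condition on free variables arises, because `Entails` has no generalization step that
could bind a variable of a premise. -/
theorem deduction (h : Entails Ax (insert A Γ) B) : Entails Ax Γ (imp A B) := by
  induction h with
  | prem h =>
    rcases h with rfl | h
    -- The identity `A → A` as S K K, with `⊥` as the auxiliary formula.
    · exact .mp (.ax (.k _ bot)) (.mp (.ax (.k _ (imp bot _))) (.ax (.s _ _ _)))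
    · exact .mp (.prem h) (.ax (.k _ _))
  | thm h => exact .mp (.thm h) (.ax (.k _ _))
  | mp _ _ ih₁ ih₂ => exact .mp ih₁ (.mp ih₂ (.ax (.s _ _ _)))

theorem deduction_iff : Entails Ax Γ (imp A B) ↔ Entails Ax (insert A Γ) B :=
  ⟨fun h => .mp (.prem (Set.mem_insert _ _)) (h.mono (Set.subset_insert _ _)), deduction⟩

theorem cut (h : Entails Ax (insert A Γ) B) (hA : Entails Ax Γ A) : Entails Ax Γ B :=
  .mp hA h.deduction

theorem and_intro (hA : Entails Ax Γ A) (hB : Entails Ax Γ B) : Entails Ax Γ (and A B) := by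
  -- The conjunction axiom needs a common antecedent; any theorem serves, here `⊥ → ⊥`.
  have hC : Entails Ax Γ (imp bot bot) := .ax (.efq _)
  exact .mp hC (.mp (.mp hB (.ax (.k _ _))) (.mp (.mp hA (.ax (.k _ _))) (.ax (.and_intro _ _ _))))

theorem and_left (h : Entails Ax Γ (and A B)) : Entails Ax Γ A := .mp h (.ax (.and_left _ _))

theorem and_right (h : Entails Ax Γ (and A B)) : Entails Ax Γ B := .mp h (.ax (.and_right _ _))

theorem or_elim (h : Entails Ax Γ (or A B)) (hA : Entails Ax (insert A Γ) C)
    (hB : Entails Ax (insert B Γ) C) : Entails Ax Γ C :=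
  .mp h (.mp hB.deduction (.mp hA.deduction (.ax (.or_elim _ _ _))))

theorem congr_of_iff (h : AxQDN4 (iff A B)) : Entails Ax Γ A ↔ Entails Ax Γ B :=
  ⟨fun hA => .mp hA (ax h).and_left, fun hB => .mp hB (ax h).and_right⟩

theorem subst (h : Entails Ax Γ A) (σ : ℕ → Tm) :
    Entails Ax ((Form.subst σ) '' Γ) (A.subst σ) := by
  induction h with
  | prem h => exact .prem ⟨_, h, rfl⟩
  | thm h => exact .thm (h.subst σ)
  | mp _ _ ih₁ ih₂ => exact .mp ih₁ ih₂

theorem all_intro_of_imp (h : Derives Ax ∅ (imp B.shift A)) : Entails Ax Γ (imp B (all A)) :=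
  .mp (.thm h.gen) (.ax (.all_intro _ _))

theorem all_elim (h : Entails Ax Γ (all A)) (t : Tm) : Entails Ax Γ (A.inst t) :=
  .mp h (.ax (.all_elim _ _))

theorem shift_all_elim (h : Entails Ax Γ (all A).shift) : Entails Ax Γ A := by
  have := h.all_elim (Tm.var 0)
  rwa [inst_lift_shift] at this

/-- Seen below one more quantifier, both premises can be instantiated at its variable, giving `B`;
the axiom `all_intro`, used for each premise in turn, restores the quantifier. -/
theorem all_mp (hA : Entails Ax Γ (all A)) (hAB : Entails Ax Γ (all (imp A B))) :
    Entails Ax Γ (all B) := by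
  have h : Entails Ax ∅ (imp (all A).shift (imp (all (imp A B)).shift B)) := by
    refine deduction (deduction ?_)
    exact .mp (shift_all_elim (A := A) (.prem (by simp)))
      (shift_all_elim (A := imp A B) (.prem (by simp)))
  exact .mp hAB (.mp (.mp hA (all_intro_of_imp h.derives)) (.ax (.all_intro _ _)))

/-- Generalization for `Entails`: the variable `0` does not occur in the shifted premises. A premise
is vacuously quantified, and modus ponens is carried under the quantifier by `all_mp`. -/
theorem all_of_shift (h : Entails Ax (shift '' Γ) A) : Entails Ax Γ (all A) := by
  induction h with
  | prem h =>
    obtain ⟨B, hB, rfl⟩ := h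
    refine .mp (.prem hB) (all_intro_of_imp (Entails.derives (deduction ?_)))
    exact .prem (Set.mem_insert _ _)
  | thm h => exact .thm h.gen
  | mp _ _ ih₁ ih₂ => exact all_mp ih₁ ih₂

/-- Generalization over a variable that is fresh for the premises and the conclusion. -/
theorem all_intro {x : ℕ} (h : Entails Ax Γ (A.inst (Tm.var x))) (hΓ : ∀ B ∈ Γ, x ∉ B.fv)
    (hA : x ∉ A.all.fv) : Entails Ax Γ (all A) := by
  refine all_of_shift ?_
  have := h.subst (abstractVar x)
  rw [inst_subst_abstractVar hA] at this
  refine this.mono ?_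
  rintro _ ⟨B, hB, rfl⟩
  exact ⟨B, hB, (subst_abstractVar (hΓ B hB)).symm⟩

/-- The Henkin step: naming a witness of an existential premise by a fresh variable yields no new
consequences free of that variable. -/
theorem ex_elim {x : ℕ} (h : Entails Ax (insert (A.inst (Tm.var x)) Γ) B) (hex : ex A ∈ Γ)
    (hΓ : ∀ B ∈ Γ, x ∉ B.fv) (hB : x ∉ B.fv) : Entails Ax Γ B := by
  have h' : Entails Ax Γ ((imp A B.shift).inst (Tm.var x)) := by
    have : (imp A B.shift).inst (Tm.var x) = imp (A.inst (Tm.var x)) (B.shift.inst (Tm.var x)) :=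
      rfl
    rw [this, shift_inst]
    exact h.deduction
  refine .mp (.prem hex) (.mp (h'.all_intro hΓ ?_) (.ax (.ex_elim _ _)))
  rintro (hx | hx)
  · exact hΓ _ hex hx
  · refine hB ?_
    have : B.shift.fv ⊆ {y | ∃ z ∈ B.fv, y = z + 1} :=
      fv_subst_subset fun z hz => by simpa [Tm.fv] using hz
    simpa using this hx

end Entails

/-! ### Soundness -/

namespace KripkeModel

variable (M : KripkeModel.{u, v})

/-- Clauses that quantify over later states are upward closed by transitivity; the others inherit
persistence from the subformulas, the domains and the valuation. -/
theorem I_mono {A : Form} {b : Bool} {w x : M.W} {ρ : ℕ → M.U} (hwx : w ≤ x)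
    (h : M.I A b w ρ) : M.I A b x ρ := by
  induction A generalizing b w x ρ with
  | bot => cases b <;> exact h
  | atom n i t =>
    cases b
    · exact M.Vneg_mono hwx n i h
    · exact M.Vpos_mono hwx n i h
  | neg A ih =>
    cases b
    · exact ih (b := true) hwx h
    · exact ih (b := false) hwx h
  | and A B ihA ihB =>
    cases b
    · exact h.imp (ihA hwx) (ihB hwx)
    · exact h.imp (ihA hwx) (ihB hwx)
  | or A B ihA ihB =>
    cases b
    · exact h.imp (ihA hwx) (ihB hwx)
    · exact h.imp (ihA hwx) (ihB hwx)
  | imp A B ihA ihB =>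
    cases b
    · exact ⟨fun y hy => h.1 y (hwx.trans hy), ihB hwx h.2⟩
    · exact fun y hy => h y (hwx.trans hy)
  | all A ih =>
    cases b
    · obtain ⟨d, hd, h⟩ := h
      exact ⟨d, M.D_mono hwx hd, ih hwx h⟩
    · exact fun y hy => h y (hwx.trans hy)
  | ex A ih =>
    cases b
    · exact fun y hy => h y (hwx.trans hy)
    · obtain ⟨d, hd, h⟩ := h
      exact ⟨d, M.D_mono hwx hd, ih hwx h⟩

theorem val_subst (ρ : ℕ → M.U) (σ : ℕ → Tm) (t : Tm) :
    M.val ρ (t.subst σ) = M.val (fun k => M.val ρ (σ k)) t := by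
  cases t <;> rfl

theorem val_push_liftSubst (d : M.U) (ρ : ℕ → M.U) (σ : ℕ → Tm) :
    (fun k => M.val (M.push d ρ) (liftSubst σ k)) = M.push d (fun k => M.val ρ (σ k)) := by
  funext k
  cases k with
  | zero => rfl
  | succ k =>
    simp only [liftSubst, val_subst]
    rfl

theorem I_subst (A : Form) (σ : ℕ → Tm) (b : Bool) (w : M.W) (ρ : ℕ → M.U) :
    M.I (A.subst σ) b w ρ ↔ M.I A b w (fun k => M.val ρ (σ k)) := by
  induction A generalizing σ b w ρ with
  | bot => cases b <;> rfl
  | atom n i t => cases b <;> simp only [Form.subst, I, val_subst]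
  | neg A ih => cases b <;> simp only [Form.subst, I, ih]
  | and A B ihA ihB => cases b <;> simp only [Form.subst, I, ihA, ihB]
  | or A B ihA ihB => cases b <;> simp only [Form.subst, I, ihA, ihB]
  | imp A B ihA ihB => cases b <;> simp only [Form.subst, I, ihA, ihB]
  | all A ih => cases b <;> simp only [Form.subst, I, ih, val_push_liftSubst]
  | ex A ih => cases b <;> simp only [Form.subst, I, ih, val_push_liftSubst]

theorem I_shift (A : Form) (b : Bool) (w : M.W) (d : M.U) (ρ : ℕ → M.U) :
    M.I A.shift b w (M.push d ρ) ↔ M.I A b w ρ :=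
  M.I_subst A _ b w _

theorem I_inst (A : Form) (t : Tm) (b : Bool) (w : M.W) (ρ : ℕ → M.U) :
    M.I (A.inst t) b w ρ ↔ M.I A b w (M.push (M.val ρ t) ρ) := by
  rw [Form.inst, I_subst]
  refine iff_of_eq (congrArg _ ?_)
  funext k
  cases k <;> rfl

/-- Substituting `c₀` for every variable leaves a sentence unchanged, so the substitution lemma
removes the assignment. -/
theorem I_sentence {A : Form} (hA : A.IsSentence) (b : Bool) (w : M.W) (ρ : ℕ → M.U) :
    M.I A b w ρ ↔ M.I A b w (fun _ => M.con 0) := by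
  have := M.I_subst A (fun _ => Tm.con 0) b w ρ
  rwa [hA.subst_eq] at this

theorem val_mem {w : M.W} {ρ : ℕ → M.U} (hρ : ∀ k, ρ k ∈ M.D w) (t : Tm) : M.val ρ t ∈ M.D w := by
  cases t with
  | con c => exact M.con_mem w c
  | var x => exact hρ x

theorem push_mem {w : M.W} {d : M.U} {ρ : ℕ → M.U} (hd : d ∈ M.D w) (hρ : ∀ k, ρ k ∈ M.D w) :
    ∀ k, M.push d ρ k ∈ M.D w := by
  rintro (_ | k)
  · exact hd
  · exact hρ k

theorem I_imp (A B : Form) (w : M.W) (ρ : ℕ → M.U) :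
    M.I (Form.imp A B) true w ρ ↔ ∀ x, w ≤ x → M.I A true x ρ → M.I B true x ρ := by
  simp only [I, imp_iff_not_or]

theorem I_iff {A B : Form} {w : M.W} {ρ : ℕ → M.U}
    (h : ∀ x, w ≤ x → (M.I A true x ρ ↔ M.I B true x ρ)) : M.I (Form.iff A B) true w ρ :=
  ⟨(M.I_imp _ _ _ _).2 fun x hx => (h x hx).1, (M.I_imp _ _ _ _).2 fun x hx => (h x hx).2⟩

/-- Matches the first half of the falsity clause for implication, which makes the axiom `neg_imp`
sound. -/
theorem I_inot_inot (A : Form) (w : M.W) (ρ : ℕ → M.U) :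
    M.I A.inot.inot true w ρ ↔ ∀ x, w ≤ x → ∃ y, x ≤ y ∧ M.I A true y ρ := by
  simp only [Form.inot, I_imp]
  simp only [I, imp_false, not_forall, not_not, exists_prop]

/-- The axioms of `QDN4` hold at all states, under all assignments of objects of the domain. -/
theorem I_of_AxQDN4 {A : Form} (h : AxQDN4 A) (w : M.W) (ρ : ℕ → M.U) (hρ : ∀ k, ρ k ∈ M.D w) :
    M.I A true w ρ := by
  have up : ∀ {A b x y ρ}, x ≤ y → M.I A b x ρ → M.I A b y ρ := fun h h' => M.I_mono h h'
  cases h with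
  | k A B => simp only [I_imp]; exact fun x _ hA y hy _ => up hy hA
  | s A B C =>
    simp only [I_imp]
    exact fun x _ h y hy h' z hz hA => h z (hy.trans hz) hA z le_rfl (h' z hz hA)
  | and_left A B => simp only [I_imp]; exact fun x _ h => h.1
  | and_right A B => simp only [I_imp]; exact fun x _ h => h.2
  | and_intro A B C =>
    simp only [I_imp]
    exact fun x _ h y hy h' z hz hC => ⟨h z (hy.trans hz) hC, h' z hz hC⟩
  | or_left A B => simp only [I_imp]; exact fun x _ h => Or.inl h
  | or_right A B => simp only [I_imp]; exact fun x _ h => Or.inr h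
  | or_elim A B C =>
    simp only [I_imp]
    exact fun x _ h y hy h' z hz hC => hC.elim (h z (hy.trans hz)) (h' z hz)
  | efq A => simp only [I_imp]; exact fun x _ h => h.elim
  | ex_intro A t =>
    simp only [I_imp, I_inst]
    exact fun x hx h => ⟨_, M.D_mono hx (M.val_mem hρ t), h⟩
  | ex_elim A B =>
    rw [I_imp]
    intro x _ h
    rw [I_imp]
    rintro y hy ⟨d, hd, hA⟩
    exact (M.I_shift B _ _ d _).1 ((M.I_imp _ _ _ _).1 (h y hy d hd) y le_rfl hA)
  | all_intro A B =>
    rw [I_imp]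
    intro x _ h
    rw [I_imp]
    intro y hy hB z hz d hd
    exact (M.I_imp _ _ _ _).1 (h z (hy.trans hz) d hd) z le_rfl
      ((M.I_shift B _ _ d _).2 (up hz hB))
  | all_elim A t =>
    simp only [I_imp, I_inst]
    exact fun x hx h => h x le_rfl _ (M.D_mono hx (M.val_mem hρ t))
  | neg_bot A => rw [I_imp]; exact fun x _ _ => trivial
  | neg_neg A => exact M.I_iff fun x _ => Iff.rfl
  | neg_and A B => exact M.I_iff fun x _ => Iff.rfl
  | neg_or A B => exact M.I_iff fun x _ => Iff.rfl
  | neg_imp A B =>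
    exact M.I_iff fun x _ => and_congr_left fun _ => (M.I_inot_inot A x ρ).symm
  | neg_all A => exact M.I_iff fun x _ => Iff.rfl
  | neg_ex A => exact M.I_iff fun x _ => Iff.rfl

theorem not_I_true_and_false (hM : M.Disjointness) (A : Form) (w : M.W) (ρ : ℕ → M.U)
    (ht : M.I A true w ρ) (hf : M.I A false w ρ) : False := by
  induction A generalizing w ρ with
  | bot => exact ht
  | atom n i t => exact (hM w n i).subset ⟨ht, hf⟩
  | neg A ih => exact ih w ρ hf ht
  | and A B ihA ihB => exact hf.elim (ihA w ρ ht.1) (ihB w ρ ht.2)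
  | or A B ihA ihB => exact ht.elim (ihA w ρ · hf.1) (ihB w ρ · hf.2)
  | imp A B ihA ihB =>
    -- Falsity of the implication supplies a later state where `A` is true; there `B` is true by the
    -- implication and false by persistence.
    obtain ⟨y, hy, hA⟩ := hf.1 w le_rfl
    exact ihB y ρ ((M.I_imp _ _ _ _).1 ht y hy hA) (M.I_mono hy hf.2)
  | all A ih =>
    obtain ⟨d, hd, hA⟩ := hf
    exact ih w _ (ht w le_rfl d hd) hA
  | ex A ih =>
    obtain ⟨d, hd, hA⟩ := ht
    exact ih w _ hA (hf w le_rfl d hd)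

theorem I_of_AxQDN3 (hM : M.Disjointness) {A : Form} (h : AxQDN3 A) (w : M.W) (ρ : ℕ → M.U)
    (hρ : ∀ k, ρ k ∈ M.D w) : M.I A true w ρ := by
  cases h with
  | of_QDN4 h => exact M.I_of_AxQDN4 h w ρ hρ
  | explosion A =>
    rw [I_imp]
    intro x _ hf
    rw [Form.inot, I_imp]
    exact fun y hy ht => M.not_I_true_and_false hM A y ρ ht (M.I_mono hy hf)

/-- The state must vary in the induction: after generalization the new object may exist only at a
later state, to which the truth of the premises persists. -/
theorem I_of_derives {Ax : Form → Prop} {Γ : Set Form} {A : Form} (h : Derives Ax Γ A)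
    (hΓ : ∀ B ∈ Γ, B.IsSentence)
    (hAx : ∀ B, Ax B → ∀ (w : M.W) (ρ : ℕ → M.U), (∀ k, ρ k ∈ M.D w) → M.I B true w ρ)
    (w : M.W) (hw : ∀ B ∈ Γ, M.Holds w B) (ρ : ℕ → M.U) (hρ : ∀ k, ρ k ∈ M.D w) :
    M.I A true w ρ := by
  induction h generalizing w ρ with
  | prem h => exact (M.I_sentence (hΓ _ h) _ _ _).2 (hw _ h)
  | ax h => exact hAx _ h w ρ hρ
  | mp _ _ ih₁ ih₂ => exact (M.I_imp _ _ _ _).1 (ih₂ w hw ρ hρ) w le_rfl (ih₁ w hw ρ hρ)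
  | gen _ ih =>
    exact fun x hx d hd => ih x (fun B hB => M.I_mono hx (hw B hB)) _
      (M.push_mem hd fun k => M.D_mono hx (hρ k))

theorem holds_of_derives {Ax : Form → Prop} {Γ : Set Form} {A : Form} (h : Derives Ax Γ A)
    (hΓ : ∀ B ∈ Γ, B.IsSentence)
    (hAx : ∀ B, Ax B → ∀ (w : M.W) (ρ : ℕ → M.U), (∀ k, ρ k ∈ M.D w) → M.I B true w ρ)
    (w : M.W) (hw : ∀ B ∈ Γ, M.Holds w B) : M.Holds w A :=
  M.I_of_derives h hΓ hAx w hw _ fun _ => M.con_mem w 0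

end KripkeModel

/-! ### Saturated extensions -/

section Saturation

open Form

variable {Ax : Form → Prop} [IsAxiomSystem Ax]

/-- One step of the construction of a saturated theory: the formula `F` is added to the premises,
together with a witness if it is existential, unless `A` becomes derivable. -/
theorem exists_saturation_step {Γ Δ : Set Form} {A : Form} {X Y : Set ℕ} (hXY : (Y \ X).Infinite)
    (hΓ : ∀ B ∈ Γ, B.fv ⊆ X) (hΔ : Δ.Finite) (hΔY : ∀ B ∈ Δ, B.fv ⊆ Y)
    (hA : ¬ Entails Ax (Γ ∪ Δ) A) (F : Form) :
    ∃ Δ' : Set Form, Δ ⊆ Δ' ∧ Δ'.Finite ∧ (∀ B ∈ Δ', B.fv ⊆ Y) ∧ ¬ Entails Ax (Γ ∪ Δ') A ∧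
      (F.fv ⊆ Y → Entails Ax (insert F (Γ ∪ Δ')) A ∨
        (F ∈ Δ' ∧ ∀ B, F = ex B → ∃ x ∈ Y, B.inst (Tm.var x) ∈ Δ')) := by
  by_cases hF : F.fv ⊆ Y
  swap
  · exact ⟨Δ, subset_rfl, hΔ, hΔY, hA, fun h => (hF h).elim⟩
  by_cases hFA : Entails Ax (insert F (Γ ∪ Δ)) A
  · exact ⟨Δ, subset_rfl, hΔ, hΔY, hA, fun _ => Or.inl hFA⟩
  rw [← Set.union_insert] at hFA
  have hΔF : ∀ B ∈ insert F Δ, B.fv ⊆ Y := by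
    rintro B (rfl | hB)
    exacts [hF, hΔY B hB]
  by_cases hex : ∃ B, F = ex B
  swap
  · exact ⟨insert F Δ, Set.subset_insert _ _, hΔ.insert F, hΔF, hFA,
      fun _ => Or.inr ⟨Set.mem_insert _ _, fun B hB => (hex ⟨B, hB⟩).elim⟩⟩
  obtain ⟨B, rfl⟩ := hex
  have hfin : (A.fv ∪ ⋃ C ∈ insert (ex B) Δ, C.fv).Finite :=
    A.finite_fv.union ((hΔ.insert _).biUnion fun C _ => C.finite_fv)
  -- Being outside `X` makes `x` fresh for `Γ`; finiteness of `Δ` allows it to be fresh for `Δ`, `ex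
  -- B` and `A` as well.
  obtain ⟨x, ⟨hxY, hxX⟩, hx⟩ := (hXY.sdiff hfin).nonempty
  simp only [Set.mem_union, Set.mem_iUnion, not_or, not_exists] at hx
  refine ⟨insert (B.inst (Tm.var x)) (insert (ex B) Δ), ?_, (hΔ.insert _).insert _, ?_, ?_, ?_⟩
  · exact (Set.subset_insert _ _).trans (Set.subset_insert _ _)
  · rintro C (rfl | hC)
    · exact fv_inst_subset (A := B) hF (Set.singleton_subset_iff.2 hxY)
    · exact hΔF C hC
  · rw [Set.union_insert]
    refine fun h => hFA (h.ex_elim (Or.inr (Set.mem_insert _ _)) ?_ hx.1)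
    rintro C (hC | hC)
    · exact fun hxC => hxX (hΓ C hC hxC)
    · exact hx.2 C hC
  · refine fun _ => Or.inr ⟨by simp, fun C hC => ⟨x, hxY, ?_⟩⟩
    cases hC
    exact Set.mem_insert _ _

/-- Every set of premises that does not entail `A` extends, with new variables, to a prime theory
that has witnesses and does not contain `A`. -/
theorem exists_saturated {Γ : Set Form} {A : Form} {X Y : Set ℕ} (hXsubY : X ⊆ Y)
    (hXY : (Y \ X).Infinite) (hΓ : ∀ B ∈ Γ, B.fv ⊆ X) (hA : ¬ Entails Ax Γ A) :
    ∃ T : Set Form, Γ ⊆ T ∧ (∀ B ∈ T, B.fv ⊆ Y) ∧ ¬ Entails Ax T A ∧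
      (∀ B, B.fv ⊆ Y → B ∉ T → Entails Ax (insert B T) A) ∧
      ∀ B, ex B ∈ T → ∃ x ∈ Y, B.inst (Tm.var x) ∈ T := by
  have : Nonempty Form := ⟨bot⟩
  obtain ⟨e, he⟩ := exists_surjective_nat Form
  -- Only finitely many formulas have been added at any stage, so infinitely many variables of `Y \
  -- X` remain unused.
  let Good := {Δ : Set Form // Δ.Finite ∧ (∀ B ∈ Δ, B.fv ⊆ Y) ∧ ¬ Entails Ax (Γ ∪ Δ) A}
  have step : ∀ (Δ : Good) (F : Form), ∃ Δ' : Good, Δ.1 ⊆ Δ'.1 ∧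
      (F.fv ⊆ Y → Entails Ax (insert F (Γ ∪ Δ'.1)) A ∨
        (F ∈ Δ'.1 ∧ ∀ B, F = ex B → ∃ x ∈ Y, B.inst (Tm.var x) ∈ Δ'.1)) := by
    rintro ⟨Δ, h1, h2, h3⟩ F
    obtain ⟨Δ', h, h1', h2', h3', hF⟩ := exists_saturation_step hXY hΓ h1 h2 h3 F
    exact ⟨⟨Δ', h1', h2', h3'⟩, h, hF⟩
  choose next hsub hnext using step
  let S : ℕ → Good := fun n =>
    Nat.rec ⟨∅, Set.finite_empty, by simp, by simpa using hA⟩ (fun n Δ => next Δ (e n)) n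
  have hS : Monotone fun n => Γ ∪ (S n).1 :=
    monotone_nat_of_le_succ fun n => Set.union_subset_union_right _ (hsub (S n) (e n))
  have hle : ∀ n, Γ ∪ (S n).1 ⊆ ⋃ n, Γ ∪ (S n).1 := fun n =>
    Set.subset_iUnion (fun n => Γ ∪ (S n).1) n
  have hover : ∀ B ∈ ⋃ n, Γ ∪ (S n).1, B.fv ⊆ Y := by
    intro B hB
    obtain ⟨n, hB | hB⟩ := Set.mem_iUnion.1 hB
    exacts [(hΓ B hB).trans hXsubY, (S n).2.2.1 B hB]
  have hTA : ¬ Entails Ax (⋃ n, Γ ∪ (S n).1) A := by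
    intro h
    obtain ⟨n, hn⟩ := h.exists_of_iUnion hS
    exact (S n).2.2.2 hn
  refine ⟨⋃ n, Γ ∪ (S n).1, Set.subset_union_left.trans (hle 0), hover, hTA, ?_, ?_⟩
  · intro B hB hBT
    obtain ⟨n, rfl⟩ := he B
    rcases hnext (S n) (e n) hB with h | h
    · exact h.mono (Set.insert_subset_insert (hle (n + 1)))
    · exact (hBT (hle (n + 1) (Or.inr h.1))).elim
  · intro B hB
    obtain ⟨n, hn⟩ := he (ex B)
    rcases hnext (S n) (e n) (hn ▸ hover _ hB) with h | h
    -- The existential formula lies in the limit theory, so it cannot have been rejected at its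
    -- stage: by cut, the theory would entail `A`.
    · refine (hTA ((h.mono (Set.insert_subset_insert (hle (n + 1)))).cut (.prem ?_))).elim
      rwa [hn]
    · obtain ⟨x, hx, hBx⟩ := h.2 B hn
      exact ⟨x, hx, hle (n + 1) (Or.inr hBx)⟩

end Saturation

/-! ### The canonical model -/

/-- The variables that serve as names of objects at the states of level `k`. -/
def levelVars (k : ℕ) : Set ℕ := {x | x.unpair.1 < k}

theorem levelVars_mono {k l : ℕ} (h : k ≤ l) : levelVars k ⊆ levelVars l :=
  fun _ hx => lt_of_lt_of_le hx h

theorem infinite_levelVars_diff (k : ℕ) : (levelVars (k + 1) \ levelVars k).Infinite := by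
  refine Set.infinite_of_injective_forall_mem (f := fun n => Nat.pair k n) ?_ ?_
  · intro m n h
    exact (Nat.pair_eq_pair.1 h).2
  · intro n
    simp [levelVars]

/-- The states of the canonical model: prime theories with witnesses. -/
structure World (Ax : Form → Prop) : Type u where
  level : ℕ
  thy : Set Form
  fv_subset : ∀ {B}, B ∈ thy → B.fv ⊆ levelVars level
  closed : ∀ {B}, B.fv ⊆ levelVars level → Entails Ax thy B → B ∈ thy
  consistent : Form.bot ∉ thy
  prime : ∀ {B C}, Form.or B C ∈ thy → B ∈ thy ∨ C ∈ thy
  witness : ∀ {B}, Form.ex B ∈ thy → ∃ x ∈ levelVars level, B.inst (Tm.var x) ∈ thy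

namespace World

open Form

variable {Ax : Form → Prop}

theorem ext {w x : World.{u} Ax} (hl : w.level = x.level) (ht : w.thy = x.thy) : w = x := by
  cases w
  cases x
  cases hl
  cases ht
  rfl

instance : PartialOrder (World.{u} Ax) where
  le w x := w.level ≤ x.level ∧ w.thy ⊆ x.thy
  le_refl w := ⟨le_rfl, subset_rfl⟩
  le_trans _ _ _ h h' := ⟨h.1.trans h'.1, h.2.trans h'.2⟩
  le_antisymm _ _ h h' := ext (h.1.antisymm h'.1) (h.2.antisymm h'.2)

theorem fv_mono {A : Form} {w x : World.{u} Ax} (hwx : w ≤ x) (hA : A.fv ⊆ levelVars w.level) :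
    A.fv ⊆ levelVars x.level :=
  hA.trans (levelVars_mono hwx.1)

theorem entails_iff {A : Form} {w : World.{u} Ax} (hA : A.fv ⊆ levelVars w.level) :
    Entails Ax w.thy A ↔ A ∈ w.thy :=
  ⟨w.closed hA, .prem⟩

variable [IsAxiomSystem Ax]

/-- Every formula of the level outside the saturated theory yields `A` when added. By cut the theory
is therefore deductively closed, and by case distinction prime; otherwise it would entail `A`
itself. -/
theorem exists_extension {k : ℕ} {Γ : Set Form} {A : Form} (hΓ : ∀ B ∈ Γ, B.fv ⊆ levelVars k)
    (hA : ¬ Entails Ax Γ A) :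
    ∃ w : World.{u} Ax, w.level = k + 1 ∧ Γ ⊆ w.thy ∧ ¬ Entails Ax w.thy A := by
  obtain ⟨T, hΓT, hover, hTA, hmax, hwit⟩ :=
    exists_saturated (levelVars_mono k.le_succ) (infinite_levelVars_diff k) hΓ hA
  refine ⟨⟨k + 1, T, hover _, ?_, ?_, ?_, hwit _⟩, rfl, hΓT, hTA⟩
  · intro B hB hTB
    by_contra hBT
    exact hTA ((hmax B hB hBT).cut hTB)
  · exact fun h => hTA (.mp (.prem h) (.ax (.efq A)))
  · intro B C hBC
    by_contra! h
    have hfv := hover _ hBC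
    exact hTA (.or_elim (.prem hBC) (hmax B (Set.subset_union_left.trans hfv) h.1)
      (hmax C (Set.subset_union_right.trans hfv) h.2))

/-! ### Membership in a theory, by connective and quantifier -/

variable {w : World.{u} Ax} {A B : Form}

theorem mem_congr (h : AxQDN4 (iff A B)) (hA : A.fv ⊆ levelVars w.level)
    (hB : B.fv ⊆ levelVars w.level) : A ∈ w.thy ↔ B ∈ w.thy := by
  rw [← entails_iff hA, ← entails_iff hB, Entails.congr_of_iff h]

theorem and_mem_iff : and A B ∈ w.thy ↔ A ∈ w.thy ∧ B ∈ w.thy := by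
  refine ⟨fun h => ⟨?_, ?_⟩, fun h => ?_⟩
  · exact w.closed (Set.subset_union_left.trans (w.fv_subset h)) (Entails.prem h).and_left
  · exact w.closed (Set.subset_union_right.trans (w.fv_subset h)) (Entails.prem h).and_right
  · exact w.closed (Set.union_subset (w.fv_subset h.1) (w.fv_subset h.2)) (.and_intro (.prem h.1) (.prem h.2))

theorem or_mem_iff (h : (or A B).fv ⊆ levelVars w.level) :
    or A B ∈ w.thy ↔ A ∈ w.thy ∨ B ∈ w.thy :=
  ⟨w.prime, fun h' => w.closed h (h'.elim (fun h' => .mp (.prem h') (.ax (.or_left _ _)))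
    fun h' => .mp (.prem h') (.ax (.or_right _ _)))⟩

theorem imp_mem_iff (h : (imp A B).fv ⊆ levelVars w.level) :
    imp A B ∈ w.thy ↔ ∀ x : World.{u} Ax, w ≤ x → A ∈ x.thy → B ∈ x.thy := by
  constructor
  · intro hAB x hx hA
    exact x.closed (fv_mono hx (Set.subset_union_right.trans h))
      (.mp (.prem hA) (.prem (hx.2 hAB)))
  · intro hAB
    by_contra hn
    -- If `A → B` is missing, then adding `A` does not entail `B`, and the extension is a later
    -- state with `A` but without `B`.
    rw [← entails_iff h, Entails.deduction_iff] at hn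
    obtain ⟨x, hxl, hx, hxB⟩ := exists_extension.{u} (k := w.level) (by
      rintro C (rfl | hC)
      exacts [Set.subset_union_left.trans h, w.fv_subset hC]) hn
    exact hxB (.prem (hAB x ⟨by omega, (Set.subset_insert _ _).trans hx⟩ (hx (Set.mem_insert _ _))))

theorem inot_inot_mem_iff (h : A.fv ⊆ levelVars w.level) :
    A.inot.inot ∈ w.thy ↔ ∀ x : World.{u} Ax, w ≤ x → ∃ y, x ≤ y ∧ A ∈ y.thy := by
  have hn : A.inot.fv ⊆ levelVars w.level := Set.union_subset h (Set.empty_subset _)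
  rw [inot, imp_mem_iff (Set.union_subset hn (Set.empty_subset _))]
  refine forall₂_congr fun x hx => ?_
  rw [inot, imp_mem_iff (fv_mono hx hn)]
  simp [x.consistent, fun y : World.{u} Ax => y.consistent]

theorem all_mem_iff (h : (all A).fv ⊆ levelVars w.level) :
    all A ∈ w.thy ↔
      ∀ x : World.{u} Ax, w ≤ x → ∀ t : Tm, t.fv ⊆ levelVars x.level → A.inst t ∈ x.thy := by
  constructor
  · intro hA x hx t ht
    exact x.closed (fv_inst_subset (fv_mono hx h) ht) (.all_elim (.prem (hx.2 hA)) t)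
  · intro hA
    by_contra hn
    -- A variable new at the next level is fresh for the theory, so entailing `A(v)` would entail
    -- the universal formula; at the extension, one level up, `v` names an object.
    obtain ⟨v, hv, hvw⟩ := (infinite_levelVars_diff w.level).nonempty
    have hnv : ¬ Entails Ax w.thy (A.inst (Tm.var v)) := fun hv' =>
      hn (w.closed h (hv'.all_intro (fun B hB hvB => hvw (w.fv_subset hB hvB)) fun hvA => hvw (h hvA)))
    obtain ⟨x, hxl, hx, hxA⟩ := exists_extension.{u} (k := w.level) (fun B hB => w.fv_subset hB) hnv
    refine hxA (.prem (hA x ⟨by omega, hx⟩ _ ?_))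
    rw [hxl]
    exact Set.singleton_subset_iff.2 hv

theorem ex_mem_iff (h : (ex A).fv ⊆ levelVars w.level) :
    ex A ∈ w.thy ↔ ∃ t : Tm, t.fv ⊆ levelVars w.level ∧ A.inst t ∈ w.thy := by
  constructor
  · intro hA
    obtain ⟨x, hx, hxA⟩ := w.witness hA
    exact ⟨Tm.var x, Set.singleton_subset_iff.2 hx, hxA⟩
  · rintro ⟨t, -, ht⟩
    exact w.closed h (.mp (.prem ht) (.ax (.ex_intro _ _)))

end World

/-- The canonical model. -/
def canonicalModel (Ax : Form → Prop) (w₀ : World.{u} Ax) : KripkeModel.{u, v} where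
  W := World.{u} Ax
  nonempty := ⟨w₀⟩
  U := ULift.{v} Tm
  con c := ⟨Tm.con c⟩
  con_injective c c' h := by simpa using h
  D w := {d | d.down.fv ⊆ levelVars w.level}
  con_mem w c := Set.empty_subset _
  D_mono {w x} (h : w ≤ x) d hd := Set.Subset.trans hd (levelVars_mono h.1)
  Vpos w n i := {d | Form.atom n i (fun j => (d j).down) ∈ w.thy}
  Vneg w n i := {d | Form.neg (Form.atom n i (fun j => (d j).down)) ∈ w.thy}
  Vpos_dom w n i d hd j := Set.Subset.trans
    (Set.subset_iUnion (fun j => (d j).down.fv) j) (w.fv_subset hd)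
  Vneg_dom w n i d hd j := Set.Subset.trans
    (Set.subset_iUnion (fun j => (d j).down.fv) j) (w.fv_subset hd)
  Vpos_mono {w x} (h : w ≤ x) n i d hd := h.2 hd
  Vneg_mono {w x} (h : w ≤ x) n i d hd := h.2 hd

section Truth

open Form World

variable {Ax : Form → Prop} (w₀ : World.{u} Ax)

theorem val_canonicalModel (ρ : ℕ → ULift.{v} Tm) (t : Tm) :
    ((canonicalModel.{u, v} Ax w₀).val ρ t).down = t.subst (fun k => (ρ k).down) := by
  cases t <;> rfl

/-- Assigning the term `d` to the bound variable amounts to instantiating the substituted body, the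
form used in `all_mem_iff` and `ex_mem_iff`. -/
theorem subst_push_canonicalModel (A : Form) (d : ULift.{v} Tm) (ρ : ℕ → ULift.{v} Tm) :
    A.subst (fun k => ((canonicalModel.{u, v} Ax w₀).push d ρ k).down) =
      (A.subst (liftSubst fun k => (ρ k).down)).inst d.down := by
  simp only [inst, subst_subst]
  congr 1
  funext k
  cases k with
  | zero => rfl
  | succ k =>
    simp only [liftSubst, Tm.subst_subst]
    exact (Tm.subst_var _).symm

theorem fv_subst_assignment_subset {k : ℕ} {ρ : ℕ → ULift.{v} Tm}
    (hρ : ∀ k', (ρ k').down.fv ⊆ levelVars k) (A : Form) :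
    (A.subst fun k => (ρ k).down).fv ⊆ levelVars k :=
  fv_subst_subset fun x _ => hρ x

theorem fv_push_canonicalModel_subset {k : ℕ} {ρ : ℕ → ULift.{v} Tm} {d : ULift.{v} Tm}
    (hρ : ∀ k', (ρ k').down.fv ⊆ levelVars k) (hd : d.down.fv ⊆ levelVars k) :
    ∀ k', ((canonicalModel.{u, v} Ax w₀).push d ρ k').down.fv ⊆ levelVars k := by
  rintro (_ | k')
  exacts [hd, hρ k']

variable [IsAxiomSystem Ax]

/-- In the canonical model, truth and falsity are membership of the formula, respectively of its
strong negation. -/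
theorem I_canonicalModel_iff (A : Form) (w : World.{u} Ax) (ρ : ℕ → ULift.{v} Tm)
    (hρ : ∀ k, (ρ k).down.fv ⊆ levelVars w.level) :
    ((canonicalModel.{u, v} Ax w₀).I A true w ρ ↔ A.subst (fun k => (ρ k).down) ∈ w.thy) ∧
    ((canonicalModel.{u, v} Ax w₀).I A false w ρ ↔
      neg (A.subst (fun k => (ρ k).down)) ∈ w.thy) := by
  induction A generalizing w ρ with
  | bot =>
    refine ⟨iff_of_false id w.consistent, iff_of_true trivial (w.closed (Set.empty_subset _) ?_)⟩
    exact .mp (A := imp bot bot) (.ax (.efq _)) (.ax (.neg_bot _))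
  | atom n i t =>
    constructor <;>
    · simp only [Form.subst, ← val_canonicalModel w₀]
      rfl
  | neg A ih =>
    have hA := fv_subst_assignment_subset hρ A
    exact ⟨(ih w ρ hρ).2, (ih w ρ hρ).1.trans (mem_congr (.neg_neg _) hA hA).symm⟩
  | and A B ihA ihB =>
    have hAB := fv_subst_assignment_subset hρ (and A B)
    constructor
    · exact (and_congr (ihA w ρ hρ).1 (ihB w ρ hρ).1).trans and_mem_iff.symm
    · exact (or_congr (ihA w ρ hρ).2 (ihB w ρ hρ).2).trans
        ((mem_congr (.neg_and _ _) hAB hAB).trans (or_mem_iff hAB)).symm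
  | or A B ihA ihB =>
    have hAB := fv_subst_assignment_subset hρ (or A B)
    constructor
    · exact (or_congr (ihA w ρ hρ).1 (ihB w ρ hρ).1).trans (or_mem_iff hAB).symm
    · exact (and_congr (ihA w ρ hρ).2 (ihB w ρ hρ).2).trans
        ((mem_congr (.neg_or _ _) hAB hAB).trans and_mem_iff).symm
  | imp A B ihA ihB =>
    have hA := fv_subst_assignment_subset hρ A
    have hB := fv_subst_assignment_subset hρ B
    have hAB := fv_subst_assignment_subset hρ (imp A B)
    have hρ' : ∀ x : World.{u} Ax, w ≤ x → ∀ k, (ρ k).down.fv ⊆ levelVars x.level :=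
      fun x hx k => (hρ k).trans (levelVars_mono hx.1)
    constructor
    · refine (KripkeModel.I_imp _ _ _ _ _).trans (Iff.trans ?_ (imp_mem_iff hAB).symm)
      exact forall₂_congr fun x hx => imp_congr (ihA x ρ (hρ' x hx)).1 (ihB x ρ (hρ' x hx)).1
    -- The axiom splits `∼(A → B)` into `¬¬A` and `∼B`, which are the two halves of the falsity
    -- clause.
    · rw [Form.subst, mem_congr (.neg_imp _ _) hAB
        (Set.union_subset (by simpa [inot, fv] using hA) hB), and_mem_iff, inot_inot_mem_iff hA]
      refine and_congr (forall₂_congr fun x hx => exists_congr fun y => and_congr_right fun hy => ?_)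
        (ihB w ρ hρ).2
      exact (ihA y ρ (hρ' y (hx.trans hy))).1
  | all A ih =>
    have hA := fv_subst_assignment_subset hρ (all A)
    have hρ' : ∀ x : World.{u} Ax, w ≤ x → ∀ k, (ρ k).down.fv ⊆ levelVars x.level :=
      fun x hx k => (hρ k).trans (levelVars_mono hx.1)
    constructor
    · refine Iff.trans ?_ (all_mem_iff hA).symm
      refine forall₂_congr fun x hx => ULift.forall.trans (forall₂_congr fun t ht => ?_)
      rw [← subst_push_canonicalModel w₀ A ⟨t⟩ ρ]
      exact (ih x _ (fv_push_canonicalModel_subset w₀ (hρ' x hx) ht)).1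
    · refine Iff.trans ?_ ((mem_congr (.neg_all _) hA hA).trans (ex_mem_iff hA)).symm
      refine ULift.exists.trans (exists_congr fun t => and_congr_right fun ht => ?_)
      refine (ih w _ (fv_push_canonicalModel_subset w₀ hρ ht)).2.trans ?_
      rw [subst_push_canonicalModel w₀ A ⟨t⟩ ρ]
      rfl
  | ex A ih =>
    have hA := fv_subst_assignment_subset hρ (ex A)
    have hρ' : ∀ x : World.{u} Ax, w ≤ x → ∀ k, (ρ k).down.fv ⊆ levelVars x.level :=
      fun x hx k => (hρ k).trans (levelVars_mono hx.1)
    constructor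
    · refine Iff.trans ?_ (ex_mem_iff hA).symm
      refine ULift.exists.trans (exists_congr fun t => and_congr_right fun ht => ?_)
      rw [← subst_push_canonicalModel w₀ A ⟨t⟩ ρ]
      exact (ih w _ (fv_push_canonicalModel_subset w₀ hρ ht)).1
    · refine Iff.trans ?_ ((mem_congr (.neg_ex _) hA hA).trans (all_mem_iff hA)).symm
      refine forall₂_congr fun x hx => ULift.forall.trans (forall₂_congr fun t ht => ?_)
      refine (ih x _ (fv_push_canonicalModel_subset w₀ (hρ' x hx) ht)).2.trans ?_
      rw [subst_push_canonicalModel w₀ A ⟨t⟩ ρ]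
      rfl

theorem holds_canonicalModel_iff {A : Form} (hA : A.IsSentence) (w : World.{u} Ax) :
    (canonicalModel.{u, v} Ax w₀).Holds w A ↔ A ∈ w.thy := by
  have := (I_canonicalModel_iff.{u, v} w₀ A w (fun _ => ⟨Tm.con 0⟩) fun _ => Set.empty_subset _).1
  rwa [hA.subst_eq] at this

end Truth

/-! ### Countermodels and the theorem -/

/-- A sentence that is not derivable from a set of sentences fails, together with the truth of the
premises, at some state of the canonical model. -/
theorem exists_countermodel {Ax : Form → Prop} [IsAxiomSystem Ax] {Γ : Set Form} {A : Form}
    (hΓ : ∀ B ∈ Γ, B.IsSentence) (hA : A.IsSentence) (h : ¬ Derives Ax Γ A) :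
    ∃ w : World.{u} Ax, (∀ B ∈ Γ, (canonicalModel.{u, v} Ax w).Holds w B) ∧
      ¬ (canonicalModel.{u, v} Ax w).Holds w A := by
  obtain ⟨w, -, hw, hwA⟩ := World.exists_extension.{u} (k := 0) (Ax := Ax) (Γ := Γ) (A := A)
    (fun B hB => by simp [(hΓ B hB).fv_eq_empty]) fun h' => h h'.derives
  refine ⟨w, fun B hB => (holds_canonicalModel_iff w (hΓ B hB) w).2 (hw hB), fun h' => hwA ?_⟩
  exact .prem ((holds_canonicalModel_iff w hA w).1 h')

/-- An atom and its strong negation in one theory would put `⊥` into it by the explosion axiom. -/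
theorem disjointness_canonicalModel (w₀ : World.{u} AxQDN3) :
    (canonicalModel.{u, v} AxQDN3 w₀).Disjointness := by
  intro w n i
  refine Set.eq_empty_of_forall_notMem fun d hd => w.consistent (w.closed (Set.empty_subset _) ?_)
  exact .mp (.prem hd.1) (.mp (.prem hd.2) (.thm (.ax (.explosion _))))

end DN

theorem mainTheorem5 (Γ : Set DN.Form) (A : DN.Form)
    (hΓ : ∀ B ∈ Γ, B.IsSentence) (hA : A.IsSentence) :
    (DN.Derives DN.AxQDN3 Γ A ↔ DN.ConsQDN3.{u, v} Γ A) ∧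
    (DN.Derives DN.AxQDN4 Γ A ↔ DN.ConsQDN4.{u, v} Γ A) := by
  refine ⟨⟨fun h M hM w hw => ?_, fun h => ?_⟩, ⟨fun h M w hw => ?_, fun h => ?_⟩⟩
  · exact M.holds_of_derives h hΓ (fun B hB => M.I_of_AxQDN3 hM hB) w hw
  · by_contra hn
    obtain ⟨w, hw, hwA⟩ := DN.exists_countermodel.{u, v} hΓ hA hn
    exact hwA (h (DN.canonicalModel _ w) (DN.disjointness_canonicalModel w) w hw)
  · exact M.holds_of_derives h hΓ (fun B hB => M.I_of_AxQDN4 hB) w hw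
  · by_contra hn
    obtain ⟨w, hw, hwA⟩ := DN.exists_countermodel.{u, v} hΓ hA hn
    exact hwA (h (DN.canonicalModel _ w) w hw)
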